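/- For one-dimensional subspaces $V,W\subseteq\mathbb{R}^d$ let $\angle(V,W)\in[0,\frac{\pi}{2}]$ be their principal angle, $\cos\angle(V,W)=\max\{v^\top w: v\in V,\ w\in W,\ \|v\|=\|w\|=1\}$, and for nonzero vectors put $\angle(v,w)=\angle(\mathrm{span}(v),\mathrm{span}(w))$. For $u_{n+1}=A_nu_n$ with invertible $A_n\in\mathbb{R}^{d\times d}$, let $\Phi(n,0)=A_{n-1}\cdots A_0$, $\Phi(0,0)=I$, and $a_{1,n}(V)=\sum_{j=1}^n\angle(\Phi(j-1,0)V,\Phi(j,0)V)$ for $V\in\mathcal{G}(1,d)$, the set of one-dimensional subspaces of $\mathbb{R}^d$. The four first angular values are $$\theta_1^{\sup,\varlimsup}=\sup_{V}\varlimsup_{n\to\infty}\tfrac1n a_{1,n}(V),\quad \theta_1^{\sup,\varliminf}=\sup_{V}\varliminf_{n\to\infty}\tfrac1n a_{1,n}(V),\quad \theta_1^{\varlimsup,\sup}=\varlimsup_{n\to\infty}\sup_{V}\tfrac1n a_{1,n}(V),\quad \theta_1^{\varliminf,\sup}=\varliminf_{n\to\infty}\sup_{V}\tfrac1n a_{1,n}(V),$$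 where $V$ runs over $\mathcal{G}(1,d)$. For $\varphi\in[0,2\pi]$ and $0<\rho\le1$ consider in $\mathbb{R}^2$ the autonomous system $$u_{n+1}=A(\rho,\varphi)u_n,\qquad A(\rho,\varphi)=D_\rho T_\varphi D_\rho^{-1}=\begin{pmatrix}\cos\varphi&-\frac1\rho\sin\varphi\\ \rho\sin\varphi&\cos\varphi\end{pmatrix},\quad D_\rho=\begin{pmatrix}1&0\\0&\rho\end{pmatrix},\quad T_\varphi=\begin{pmatrix}\cos\varphi&-\sin\varphi\\ \sin\varphi&\cos\varphi\end{pmatrix},$$ and let $g(x,\varphi,\rho)=\angle(x,A(\rho,\varphi)x)$ for $x\ne0$. Let $\mathbb{T}\subset\mathbb{R}^2$ be the unit circle with arc length measure $\mu_1$. Then the following hold. (i) For all $(\varphi,\rho)\in[0,2\pi]\times(0,1]$ the four first angular values of this system coincide. Their common value $\theta_1(\varphi,\rho)$ is $$\theta_1(\varphi,\rho)=\frac1{2\pi}\int_{\mathbb{T}}g(D_\rho\xi,\varphi,\rho)\,d\mu_1(\xi)\quad\text{if }\varphi\notin\pi\mathbb{Q},\qquad \theta_1(\varphi,\rho)=\sup_{x\in\mathbb{T}}\frac1q\sum_{j=0}^{q-1}g(D_\rho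 T_\varphi^jD_\rho^{-1}x,\varphi,\rho)$$ where the second formula holds whenever $\frac{\varphi}{2\pi}=\frac pq$ with coprime integers $p\ge0$, $q\ge1$. (ii) The function $\theta_1:[0,2\pi]\times(0,1]\to\mathbb{R}$ is (jointly) upper semicontinuous. (iii) Lower semicontinuity fails: for every integer $q\ge2$ and every $\rho$ with $0<\rho<\tan\frac{\pi}{2q}$, the function $\varphi\mapsto\theta_1(\varphi,\rho)$ on $[0,2\pi]$ is not lower semicontinuous at $\varphi=\frac{\pi}{q}$. -/

import Mathlib

open Real Set Filter Topology

noncomputable section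

/-- The principal angle `∠(V, W) ∈ [0, π/2]` of two one-dimensional subspaces of `ℝ^d`, given by
`cos ∠(V, W) = max {vᵀ w : v ∈ V, w ∈ W, ‖v‖ = ‖w‖ = 1}`. -/
def lineAngle {d : ℕ} (V W : Submodule ℝ (EuclideanSpace ℝ (Fin d))) : ℝ :=
  Real.arccos (sSup {c : ℝ | ∃ v ∈ V, ∃ w ∈ W, ‖v‖ = 1 ∧ ‖w‖ = 1 ∧ c = inner ℝ v w})

/-- The principal angle `∠(v, w) = ∠(span v, span w)` of two nonzero vectors. -/
def vecAngle {d : ℕ} (v w : EuclideanSpace ℝ (Fin d)) : ℝ :=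
  lineAngle (Submodule.span ℝ {v}) (Submodule.span ℝ {w})

/-- The Grassmannian `G(1, d)` of one-dimensional subspaces of `ℝ^d`. -/
def LineGrassmannian (d : ℕ) : Type :=
  {V : Submodule ℝ (EuclideanSpace ℝ (Fin d)) // Module.finrank ℝ V = 1}

/-- The solution operator `Φ(n, 0) = A_{n-1} ⋯ A_0` of `u_{n+1} = A_n u_n`. -/
def solOp {d : ℕ} (A : ℕ → Matrix (Fin d) (Fin d) ℝ) : ℕ → Matrix (Fin d) (Fin d) ℝ
  | 0 => 1
  | n + 1 => A n * solOp A n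

/-- The image `Φ(n, 0) V` of a line under the solution operator. -/
def flowLine {d : ℕ} (A : ℕ → Matrix (Fin d) (Fin d) ℝ) (n : ℕ) (V : LineGrassmannian d) :
    Submodule ℝ (EuclideanSpace ℝ (Fin d)) :=
  Submodule.map (Matrix.toEuclideanLin (solOp A n)) V.1

/-- The average `(1/n) a_{1,n}(V)`, where
`a_{1,n}(V) = ∑_{j=1}^n ∠(Φ(j-1, 0) V, Φ(j, 0) V)`. -/
def angleAverage {d : ℕ} (A : ℕ → Matrix (Fin d) (Fin d) ℝ) (n : ℕ)
    (V : LineGrassmannian d) : ℝ :=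
  (1 / (n : ℝ)) * ∑ j ∈ Finset.Icc 1 n, lineAngle (flowLine A (j - 1) V) (flowLine A j V)

/-- The outer first angular value `sup_V limsup_n (1/n) a_{1,n}(V)`. -/
def outerLimsupValue {d : ℕ} (A : ℕ → Matrix (Fin d) (Fin d) ℝ) : ℝ :=
  ⨆ V : LineGrassmannian d, limsup (fun n : ℕ => angleAverage A n V) atTop

/-- The outer first angular value `sup_V liminf_n (1/n) a_{1,n}(V)`. -/
def outerLiminfValue {d : ℕ} (A : ℕ → Matrix (Fin d) (Fin d) ℝ) : ℝ :=
  ⨆ V : LineGrassmannian d, liminf (fun n : ℕ => angleAverage A n V) atTop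

/-- The inner first angular value `limsup_n sup_V (1/n) a_{1,n}(V)`. -/
def innerLimsupValue {d : ℕ} (A : ℕ → Matrix (Fin d) (Fin d) ℝ) : ℝ :=
  limsup (fun n : ℕ => ⨆ V : LineGrassmannian d, angleAverage A n V) atTop

/-- The inner first angular value `liminf_n sup_V (1/n) a_{1,n}(V)`. -/
def innerLiminfValue {d : ℕ} (A : ℕ → Matrix (Fin d) (Fin d) ℝ) : ℝ :=
  liminf (fun n : ℕ => ⨆ V : LineGrassmannian d, angleAverage A n V) atTop

/-- The rotation matrix `T_φ`. -/
def rotMat (φ : ℝ) : Matrix (Fin 2) (Fin 2) ℝ :=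
  !![cos φ, -sin φ; sin φ, cos φ]

/-- The scaling matrix `D_ρ = diag(1, ρ)`. -/
def scaleMat (ρ : ℝ) : Matrix (Fin 2) (Fin 2) ℝ :=
  !![1, 0; 0, ρ]

/-- The system matrix `A(ρ, φ) = D_ρ T_φ D_ρ⁻¹`. -/
def modelMat (φ ρ : ℝ) : Matrix (Fin 2) (Fin 2) ℝ :=
  scaleMat ρ * rotMat φ * (scaleMat ρ)⁻¹

theorem modelMat_eq (φ ρ : ℝ) (hρ : ρ ≠ 0) :
    modelMat φ ρ = !![cos φ, -(1 / ρ) * sin φ; ρ * sin φ, cos φ] := by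
  have h : (scaleMat ρ)⁻¹ = !![1, 0; 0, 1 / ρ] := by
    apply Matrix.inv_eq_right_inv
    ext i j
    fin_cases i <;> fin_cases j <;> simp [scaleMat, Matrix.mul_apply, Fin.sum_univ_two, hρ]
  rw [modelMat, h]
  ext i j
  fin_cases i <;> fin_cases j <;>
    simp [scaleMat, rotMat, Matrix.mul_apply, Fin.sum_univ_two] <;> field_simp

/-- The autonomous system `u_{n+1} = A(ρ, φ) u_n` as a sequence of matrices. -/
def modelSystem (φ ρ : ℝ) : ℕ → Matrix (Fin 2) (Fin 2) ℝ :=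
  fun _ => modelMat φ ρ

/-- The function `g(x, φ, ρ) = ∠(x, A(ρ, φ) x)`. -/
def stepAngle (x : EuclideanSpace ℝ (Fin 2)) (φ ρ : ℝ) : ℝ :=
  vecAngle x (Matrix.toEuclideanLin (modelMat φ ρ) x)

/-- The mean `(1/2π) ∫_𝕋 g(D_ρ ξ, φ, ρ) dμ₁(ξ)` over the unit circle with respect to arc length. -/
def circleMean (φ ρ : ℝ) : ℝ :=
  (1 / (2 * π)) *
    ∫ t in (0 : ℝ)..(2 * π), stepAngle (Matrix.toEuclideanLin (scaleMat ρ) !₂[cos t, sin t]) φ ρ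

/-- The orbit mean `(1/q) ∑_{j=0}^{q-1} g(D_ρ T_φ^j D_ρ⁻¹ x, φ, ρ)`. -/
def orbitMean (q : ℕ) (x : EuclideanSpace ℝ (Fin 2)) (φ ρ : ℝ) : ℝ :=
  (1 / (q : ℝ)) * ∑ j ∈ Finset.range q,
    stepAngle (Matrix.toEuclideanLin (scaleMat ρ * rotMat φ ^ j * (scaleMat ρ)⁻¹) x) φ ρ

/-- The first angular value `θ₁(φ, ρ)` of `u_{n+1} = D_ρ T_φ D_ρ⁻¹ u_n`, taken as the outer value
with the upper limit. That the other three types agree with it is part of the theorem. -/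
def firstAngularValue (φ ρ : ℝ) : ℝ :=
  outerLimsupValue (modelSystem φ ρ)

end

/-! In the coordinates `D_ρ (cos t, sin t)` the system is the translation t ↦ t + φ, so every
angular average is a Birkhoff average of the continuous π-periodic function `ellipseStep φ ρ`. These
averages converge uniformly in t: to the mean when φ/π is irrational (Weyl,
`tendsto_birkhoffAverage_addCircle`), to the mean over q steps when qφ ∈ πℤ. Uniformity lets
supremum and limit commute, so all four values equal the supremum of the limit function.

Upper semicontinuity: the value is below y once, at a single time n, all averages lie below some y'
< y, and by compactness this condition survives small changes of (φ, ρ).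

Lower semicontinuity: `circleMean` is continuous in φ and equals the value at irrational multiples
of π, so it fails wherever `circleMean` is smaller than the value. At φ = π/q the oriented angles
along an orbit telescope to half a turn, so orbit means are at most π/q. One orbit attains π/q,
while an orbit with an obtuse step stays strictly below; averaging over all orbits gives
`circleMean_lt_firstAngularValue`. -/

noncomputable section

/-! ### Polar angle on the ellipse and its continuity -/

/-- The point `D_ρ (cos t, sin t)` of the ellipse with half axes `1` and `ρ`. -/
def ellipsePoint (ρ t : ℝ) : EuclideanSpace ℝ (Fin 2) := !₂[cos t, ρ * sin t]

/-- A continuous choice of the polar angle of `ellipsePoint ρ t`. -/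
@[irreducible] def ellipseAngle (ρ t : ℝ) : ℝ :=
  t + arctan ((ρ - 1) * sin t * cos t / (cos t ^ 2 + ρ * sin t ^ 2))

/-- The principal angle between the lines through `ellipsePoint ρ t` and
`ellipsePoint ρ (t + φ)`. -/
@[irreducible] def ellipseStep (φ ρ t : ℝ) : ℝ :=
  arccos |cos (ellipseAngle ρ (t + φ) - ellipseAngle ρ t)|

theorem cos_sq_add_mul_sin_sq_pos {ρ : ℝ} (hρ : 0 < ρ) (t : ℝ) :
    0 < cos t ^ 2 + ρ * sin t ^ 2 := by
  have h := sin_sq_add_cos_sq t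
  by_cases hs : sin t = 0
  · rw [hs] at h ⊢; nlinarith
  · have : 0 < ρ * sin t ^ 2 := by positivity
    positivity

/-- The quotient inside the arctangent in `ellipseAngle` is the cross product of (cos t, sin t) with
the ellipse point, divided by their inner product. The latter is positive, so the arctangent is
exactly the angle between them. -/
theorem exists_polar_ellipseAngle {ρ : ℝ} (hρ : 0 < ρ) (t : ℝ) :
    ∃ r : ℝ, 0 < r ∧ r * cos (ellipseAngle ρ t) = cos t ∧
      r * sin (ellipseAngle ρ t) = ρ * sin t := by
  have hD := cos_sq_add_mul_sin_sq_pos hρ t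
  have h1 := sin_sq_add_cos_sq t
  unfold ellipseAngle
  set D := cos t ^ 2 + ρ * sin t ^ 2 with hDdef
  set x := (ρ - 1) * sin t * cos t / D with hx
  have hxD : x * D = (ρ - 1) * sin t * cos t := by rw [hx]; field_simp
  have hs : 0 < √(1 + x ^ 2) := by positivity
  refine ⟨D * √(1 + x ^ 2), by positivity, ?_, ?_⟩
  · rw [cos_add, cos_arctan, sin_arctan]
    field_simp
    have : D * (cos t - x * sin t) = D * cos t - sin t * (x * D) := by ring
    rw [this, hxD, hDdef]
    linear_combination cos t * h1
  · rw [sin_add, cos_arctan, sin_arctan]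
    field_simp
    have : D * (sin t + x * cos t) = D * sin t + cos t * (x * D) := by ring
    rw [this, hxD, hDdef]
    linear_combination ρ * sin t * h1

theorem ellipseAngle_add_pi (ρ t : ℝ) : ellipseAngle ρ (t + π) = ellipseAngle ρ t + π := by
  simp only [ellipseAngle, sin_add_pi, cos_add_pi]
  ring_nf

theorem ellipseStep_add_pi (φ ρ t : ℝ) : ellipseStep φ ρ (t + π) = ellipseStep φ ρ t := by
  have h : t + π + φ = t + φ + π := by ring
  simp only [ellipseStep, h, ellipseAngle_add_pi]
  ring_nf

theorem ellipseStep_periodic (φ ρ : ℝ) : Function.Periodic (ellipseStep φ ρ) π :=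
  ellipseStep_add_pi φ ρ

theorem ellipseStep_nonneg (φ ρ t : ℝ) : 0 ≤ ellipseStep φ ρ t := by
  rw [ellipseStep]; exact arccos_nonneg _

theorem ellipseStep_le_pi (φ ρ t : ℝ) : ellipseStep φ ρ t ≤ π := by
  rw [ellipseStep]; exact arccos_le_pi _

theorem continuousAt_ellipseAngle {ρ : ℝ} (hρ : 0 < ρ) (t : ℝ) :
    ContinuousAt (fun z : ℝ × ℝ => ellipseAngle z.1 z.2) (ρ, t) := by
  unfold ellipseAngle
  have hD := (cos_sq_add_mul_sin_sq_pos hρ t).ne'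
  refine continuousAt_snd.add (continuous_arctan.continuousAt.comp ?_)
  refine ContinuousAt.div ?_ ?_ hD <;> exact Continuous.continuousAt (by fun_prop)

theorem continuousAt_ellipseStep {ρ : ℝ} (hρ : 0 < ρ) (φ t : ℝ) :
    ContinuousAt (fun z : (ℝ × ℝ) × ℝ => ellipseStep z.1.1 z.1.2 z.2) ((φ, ρ), t) := by
  have h1 : ContinuousAt (fun z : (ℝ × ℝ) × ℝ => ellipseAngle z.1.2 (z.2 + z.1.1)) ((φ, ρ), t) :=
    ContinuousAt.comp (f := fun z : (ℝ × ℝ) × ℝ => (z.1.2, z.2 + z.1.1))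
      (g := fun z : ℝ × ℝ => ellipseAngle z.1 z.2)
      (continuousAt_ellipseAngle hρ _) (Continuous.continuousAt (by fun_prop))
  have h2 : ContinuousAt (fun z : (ℝ × ℝ) × ℝ => ellipseAngle z.1.2 z.2) ((φ, ρ), t) :=
    ContinuousAt.comp (f := fun z : (ℝ × ℝ) × ℝ => (z.1.2, z.2))
      (g := fun z : ℝ × ℝ => ellipseAngle z.1 z.2)
      (continuousAt_ellipseAngle hρ _) (Continuous.continuousAt (by fun_prop))
  have h3 : Continuous fun x : ℝ => arccos |cos x| := continuous_arccos.comp continuous_cos.abs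
  simp only [ellipseStep]
  exact h3.continuousAt.tendsto.comp (h1.sub h2)

theorem continuous_ellipseStep_uncurry {ρ : ℝ} (hρ : 0 < ρ) :
    Continuous (fun z : ℝ × ℝ => ellipseStep z.1 ρ z.2) := by
  refine continuous_iff_continuousAt.2 fun z => ?_
  have h : Continuous fun z : ℝ × ℝ => ((z.1, ρ), z.2) := by fun_prop
  exact (continuousAt_ellipseStep hρ z.1 z.2).tendsto.comp h.continuousAt

theorem continuous_ellipseStep {ρ : ℝ} (hρ : 0 < ρ) (φ : ℝ) :
    Continuous (ellipseStep φ ρ) :=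
  (continuous_ellipseStep_uncurry hρ).comp (by fun_prop : Continuous fun t : ℝ => (φ, t))

/-! ### Principal angles of lines and conjugacy with a translation -/

theorem norm_cos_sin (a : ℝ) : ‖(!₂[cos a, sin a] : EuclideanSpace ℝ (Fin 2))‖ = 1 := by
  simp [EuclideanSpace.norm_eq, Fin.sum_univ_two]

theorem inner_cos_sin (a b : ℝ) :
    inner ℝ (!₂[cos a, sin a] : EuclideanSpace ℝ (Fin 2)) !₂[cos b, sin b] = cos (a - b) := by
  simp [PiLp.inner_apply, Fin.sum_univ_two, cos_sub]
  ring

theorem lineAngle_span_cos_sin (a b : ℝ) :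
    lineAngle (Submodule.span ℝ {(!₂[cos a, sin a] : EuclideanSpace ℝ (Fin 2))})
      (Submodule.span ℝ {!₂[cos b, sin b]}) = arccos |cos (a - b)| := by
  have key : IsGreatest {c : ℝ |
      ∃ v ∈ Submodule.span ℝ {(!₂[cos a, sin a] : EuclideanSpace ℝ (Fin 2))},
      ∃ w ∈ Submodule.span ℝ {(!₂[cos b, sin b] : EuclideanSpace ℝ (Fin 2))},
        ‖v‖ = 1 ∧ ‖w‖ = 1 ∧ c = inner ℝ v w} |cos (a - b)| := by
    constructor
    · rcases abs_cases (cos (a - b)) with ⟨h, -⟩ | ⟨h, -⟩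
      · exact ⟨_, Submodule.mem_span_singleton_self _, _, Submodule.mem_span_singleton_self _,
          norm_cos_sin a, norm_cos_sin b, by rw [inner_cos_sin, h]⟩
      · exact ⟨_, neg_mem (Submodule.mem_span_singleton_self _), _,
          Submodule.mem_span_singleton_self _,
          by rw [norm_neg, norm_cos_sin], norm_cos_sin b, by rw [inner_neg_left, inner_cos_sin, h]⟩
    · rintro c ⟨v, hv, w, hw, hv1, hw1, rfl⟩
      obtain ⟨x, rfl⟩ := Submodule.mem_span_singleton.1 hv
      obtain ⟨y, rfl⟩ := Submodule.mem_span_singleton.1 hw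
      rw [norm_smul, norm_cos_sin, mul_one, norm_eq_abs] at hv1 hw1
      rw [real_inner_smul_left, real_inner_smul_right, inner_cos_sin]
      refine (le_abs_self _).trans ?_
      rw [abs_mul, abs_mul, hv1, hw1, one_mul, one_mul]
  rw [lineAngle, key.csSup_eq]

theorem span_ellipsePoint {ρ : ℝ} (hρ : 0 < ρ) (t : ℝ) :
    Submodule.span ℝ {ellipsePoint ρ t} =
      Submodule.span ℝ {!₂[cos (ellipseAngle ρ t), sin (ellipseAngle ρ t)]} := by
  obtain ⟨r, hr, hc, hs⟩ := exists_polar_ellipseAngle hρ t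
  have : ellipsePoint ρ t = r • !₂[cos (ellipseAngle ρ t), sin (ellipseAngle ρ t)] := by
    ext i; fin_cases i <;> simp [ellipsePoint, hc, hs]
  rw [this, Submodule.span_singleton_smul_eq (IsUnit.mk0 r hr.ne')]

theorem lineAngle_span_ellipsePoint {ρ : ℝ} (hρ : 0 < ρ) (φ t : ℝ) :
    lineAngle (Submodule.span ℝ {ellipsePoint ρ t}) (Submodule.span ℝ {ellipsePoint ρ (t + φ)}) =
      ellipseStep φ ρ t := by
  rw [span_ellipsePoint hρ, span_ellipsePoint hρ, lineAngle_span_cos_sin, ellipseStep,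
    ← cos_neg, neg_sub]

/-- The conjugacy behind everything: `A(ρ, φ) D_ρ = D_ρ T_φ`, and the rotation adds φ to the
parameter. -/
theorem modelMat_ellipsePoint {ρ : ℝ} (hρ : 0 < ρ) (φ t : ℝ) :
    Matrix.toEuclideanLin (modelMat φ ρ) (ellipsePoint ρ t) = ellipsePoint ρ (t + φ) := by
  rw [modelMat_eq φ ρ hρ.ne']
  ext i
  fin_cases i <;>
    simp [ellipsePoint, Matrix.toLpLin_apply, cos_add, sin_add] <;> field_simp <;> ring

theorem toEuclideanLin_mul_apply (A B : Matrix (Fin 2) (Fin 2) ℝ)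
    (x : EuclideanSpace ℝ (Fin 2)) :
    Matrix.toEuclideanLin (A * B) x = Matrix.toEuclideanLin A (Matrix.toEuclideanLin B x) := by
  simp [Matrix.toLpLin_apply]

theorem toEuclideanLin_one_apply (x : EuclideanSpace ℝ (Fin 2)) :
    Matrix.toEuclideanLin (1 : Matrix (Fin 2) (Fin 2) ℝ) x = x := by
  simp

theorem solOp_ellipsePoint {ρ : ℝ} (hρ : 0 < ρ) (φ t : ℝ) (n : ℕ) :
    Matrix.toEuclideanLin (solOp (modelSystem φ ρ) n) (ellipsePoint ρ t) =
      ellipsePoint ρ (t + n * φ) := by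
  induction n with
  | zero => simp only [solOp, toEuclideanLin_one_apply, Nat.cast_zero, zero_mul, add_zero]
  | succ n ih =>
    rw [solOp, toEuclideanLin_mul_apply, ih, modelSystem, modelMat_ellipsePoint hρ]
    push_cast; ring_nf

theorem isUnit_scaleMat {ρ : ℝ} (hρ : 0 < ρ) : IsUnit (scaleMat ρ).det := by
  simp [scaleMat, Matrix.det_fin_two_of, hρ.ne']

theorem scaleMat_mul_rotMat_pow_mul_inv {ρ : ℝ} (hρ : 0 < ρ) (φ : ℝ) (n : ℕ) :
    scaleMat ρ * rotMat φ ^ n * (scaleMat ρ)⁻¹ = solOp (modelSystem φ ρ) n := by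
  have hu := isUnit_scaleMat hρ
  induction n with
  | zero => simp [solOp, Matrix.mul_nonsing_inv _ hu]
  | succ n ih =>
    rw [solOp, ← ih, modelSystem, modelMat, pow_succ']
    simp only [Matrix.mul_assoc, Matrix.nonsing_inv_mul_cancel_left _ _ hu]

theorem stepAngle_ellipsePoint {ρ : ℝ} (hρ : 0 < ρ) (φ t : ℝ) :
    stepAngle (ellipsePoint ρ t) φ ρ = ellipseStep φ ρ t := by
  rw [stepAngle, vecAngle, modelMat_ellipsePoint hρ, lineAngle_span_ellipsePoint hρ]

theorem stepAngle_smul {c : ℝ} (hc : c ≠ 0) (x : EuclideanSpace ℝ (Fin 2)) (φ ρ : ℝ) :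
    stepAngle (c • x) φ ρ = stepAngle x φ ρ := by
  rw [stepAngle, stepAngle, vecAngle, vecAngle, map_smul,
    Submodule.span_singleton_smul_eq (IsUnit.mk0 c hc),
    Submodule.span_singleton_smul_eq (IsUnit.mk0 c hc)]

theorem scaleMat_cos_sin (ρ t : ℝ) :
    Matrix.toEuclideanLin (scaleMat ρ) !₂[cos t, sin t] = ellipsePoint ρ t := by
  ext i
  fin_cases i <;>
    simp [ellipsePoint, scaleMat, Matrix.toLpLin_apply, mul_comm]

theorem circleMean_eq {ρ : ℝ} (hρ : 0 < ρ) (φ : ℝ) :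
    circleMean φ ρ = (1 / (2 * π)) * ∫ t in (0 : ℝ)..(2 * π), ellipseStep φ ρ t := by
  simp only [circleMean, scaleMat_cos_sin, stepAngle_ellipsePoint hρ]

theorem exists_smul_ellipsePoint {ρ : ℝ} (hρ : 0 < ρ) {x : EuclideanSpace ℝ (Fin 2)}
    (hx : x ≠ 0) : ∃ c : ℝ, c ≠ 0 ∧ ∃ t, x = c • ellipsePoint ρ t := by
  -- This is `D_ρ⁻¹ x` read as a complex number; its modulus and argument are the required c and t.
  set z : ℂ := ⟨x 0, x 1 / ρ⟩ with hz
  have hz0 : z ≠ 0 := by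
    intro h
    apply hx
    have h0 := congrArg Complex.re h
    have h1 := congrArg Complex.im h
    simp only [hz, Complex.zero_re, Complex.zero_im, div_eq_zero_iff, hρ.ne', or_false] at h0 h1
    ext i; fin_cases i <;> simp [h0, h1]
  refine ⟨‖z‖, norm_ne_zero_iff.2 hz0, Complex.arg z, ?_⟩
  have h0 := Complex.norm_mul_cos_arg z
  have h1 := Complex.norm_mul_sin_arg z
  ext i; fin_cases i
  · simp [ellipsePoint, hz]
  · have : ‖z‖ * (ρ * sin (Complex.arg z)) = ρ * (‖z‖ * sin (Complex.arg z)) := by ring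
    simp only [ellipsePoint, PiLp.smul_apply, smul_eq_mul, Fin.mk_one,
      Matrix.cons_val_one, Matrix.cons_val_fin_one]
    rw [this, h1, hz]; field_simp

theorem ellipsePoint_ne_zero {ρ : ℝ} (hρ : 0 < ρ) (t : ℝ) : ellipsePoint ρ t ≠ 0 := by
  intro h
  have h0 := congrArg (fun v : EuclideanSpace ℝ (Fin 2) => v 0) h
  have h1 := congrArg (fun v : EuclideanSpace ℝ (Fin 2) => v 1) h
  have h2 := sin_sq_add_cos_sq t
  simp [ellipsePoint, hρ.ne'] at h0 h1
  simp [h0, h1] at h2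

/-- The line through `ellipsePoint ρ t`. -/
def ellipseLine {ρ : ℝ} (hρ : 0 < ρ) (t : ℝ) : LineGrassmannian 2 :=
  ⟨Submodule.span ℝ {ellipsePoint ρ t}, finrank_span_singleton (ellipsePoint_ne_zero hρ t)⟩

theorem ellipseLine_surjective {ρ : ℝ} (hρ : 0 < ρ) : Function.Surjective (ellipseLine hρ) := by
  rintro ⟨V, hV⟩
  obtain ⟨⟨v, hvV⟩, hv0, hv⟩ := finrank_eq_one_iff'.1 hV
  obtain ⟨c, hc, t, hct⟩ := exists_smul_ellipsePoint hρ (x := v) fun h => hv0 (by simp [h])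
  refine ⟨t, Subtype.ext (le_antisymm ?_ fun w hw => ?_)⟩
  · refine (Submodule.span_singleton_le_iff_mem _ _).2 ?_
    rw [show ellipsePoint ρ t = c⁻¹ • v by rw [hct, smul_smul, inv_mul_cancel₀ hc, one_smul]]
    exact V.smul_mem _ hvV
  · obtain ⟨a, ha⟩ := hv ⟨w, hw⟩
    have ha : a • v = w := congrArg Subtype.val ha
    rw [← ha, hct]
    exact Submodule.smul_mem _ _ (Submodule.smul_mem _ _ (Submodule.mem_span_singleton_self _))

/-- The Birkhoff average `(1/n) ∑_{j<n} f(t + jφ)` of `f` along the translation by `φ`. -/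
def birkhoffMean (f : ℝ → ℝ) (φ : ℝ) (n : ℕ) (t : ℝ) : ℝ :=
  (1 / (n : ℝ)) * ∑ j ∈ Finset.range n, f (t + j * φ)

theorem angleAverage_ellipseLine {ρ : ℝ} (hρ : 0 < ρ) (φ t : ℝ) (n : ℕ) :
    angleAverage (modelSystem φ ρ) n (ellipseLine hρ t) =
      birkhoffMean (ellipseStep φ ρ) φ n t := by
  have hflow : ∀ k, flowLine (modelSystem φ ρ) k (ellipseLine hρ t) =
      Submodule.span ℝ {ellipsePoint ρ (t + k * φ)} := fun k => by
    rw [flowLine, ellipseLine, Submodule.map_span, image_singleton, solOp_ellipsePoint hρ]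
  rw [angleAverage, birkhoffMean, ← Finset.Ico_add_one_right_eq_Icc,
    Finset.sum_Ico_eq_sum_range, Nat.add_sub_cancel]
  congr 1
  refine Finset.sum_congr rfl fun j _ => ?_
  rw [Nat.add_sub_cancel_left, hflow, hflow, ← lineAngle_span_ellipsePoint hρ]
  push_cast
  ring_nf

theorem orbitMean_smul_ellipsePoint {ρ : ℝ} (hρ : 0 < ρ) (φ t : ℝ) (q : ℕ) {c : ℝ} (hc : c ≠ 0) :
    orbitMean q (c • ellipsePoint ρ t) φ ρ = birkhoffMean (ellipseStep φ ρ) φ q t := by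
  simp only [orbitMean, birkhoffMean, scaleMat_mul_rotMat_pow_mul_inv hρ, map_smul,
    solOp_ellipsePoint hρ, stepAngle_smul hc, stepAngle_ellipsePoint hρ]

/-! ### Weyl equidistribution on the circle -/

open MeasureTheory in
/-- The integral against the normalized Haar measure as a continuous linear functional on the
continuous functions on the circle. -/
def haarIntegralCLM (T : ℝ) [Fact (0 < T)] : C(AddCircle T, ℂ) →L[ℂ] ℂ :=
  LinearMap.mkContinuous
    { toFun := fun h => ∫ x, h x ∂AddCircle.haarAddCircle
      map_add' := fun f g => integral_add
        (f.continuous.integrable_of_hasCompactSupport (HasCompactSupport.of_compactSpace _))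
        (g.continuous.integrable_of_hasCompactSupport (HasCompactSupport.of_compactSpace _))
      map_smul' := fun c f => integral_smul c _ } 1 fun h => by
    have := norm_integral_le_of_norm_le_const (μ := AddCircle.haarAddCircle (T := T))
      (Eventually.of_forall h.norm_coe_le_norm)
    simpa using this

/-- Translation by T/(2m) changes the sign of the character, while Haar measure is translation
invariant. -/
theorem haarIntegralCLM_fourier {T : ℝ} [Fact (0 < T)] {m : ℤ} (hm : m ≠ 0) :
    haarIntegralCLM T (fourier m) = 0 :=
  MeasureTheory.integral_eq_zero_of_add_right_eq_neg
    (μ := AddCircle.haarAddCircle) (fourier_add_half_inv_index hm (Fact.out : 0 < T))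

/-- **Weyl equidistribution**: the Birkhoff averages of a continuous function along an irrational
rotation of the circle converge uniformly to its mean. -/
theorem tendsto_birkhoffAverage_addCircle {T : ℝ} [Fact (0 < T)] {a : AddCircle T}
    (ha : ∀ n : ℤ, n ≠ 0 → n • a ≠ 0) (h : C(AddCircle T, ℂ)) :
    Tendsto (fun n => birkhoffAverage ℂ
        (ContinuousMap.compRightAlgHom ℂ ℂ (ContinuousMap.addRight a)).toLinearMap id n h)
      atTop (𝓝 (ContinuousMap.const _ (haarIntegralCLM T h))) := by
  set K : C(AddCircle T, ℂ) →ₗ[ℂ] C(AddCircle T, ℂ) :=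
    (ContinuousMap.compRightAlgHom ℂ ℂ (ContinuousMap.addRight a)).toLinearMap with hK
  have hKapp : ∀ (u : C(AddCircle T, ℂ)) x, K u x = u (x + a) := fun u x => rfl
  have hlip : LipschitzWith 1 K := by
    refine LipschitzWith.of_dist_le_mul fun u v => ?_
    rw [NNReal.coe_one, one_mul, ContinuousMap.dist_le dist_nonneg]
    intro x
    exact ContinuousMap.dist_apply_le_dist (f := u) (g := v) (x + a)
  let P : C(AddCircle T, ℂ) →L[ℂ] C(AddCircle T, ℂ) :=
    (haarIntegralCLM T).smulRight (1 : C(AddCircle T, ℂ))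
  have hPapp : ∀ u x, P u x = haarIntegralCLM T u := fun u x => by simp [P]
  let A : ℕ → C(AddCircle T, ℂ) →ₗ[ℂ] C(AddCircle T, ℂ) := fun n =>
    (n : ℂ)⁻¹ • ∑ j ∈ Finset.range n, K ^ j
  have hA : ∀ n u, birkhoffAverage ℂ K id n u = A n u := fun n u => by
    simp [A, birkhoffAverage, birkhoffSum, Module.End.pow_apply]
  suffices H : ∀ u, Tendsto (fun n => birkhoffAverage ℂ K id n u) atTop (𝓝 (P u)) by
    convert H h using 2
    ext x
    simp [hPapp]
  -- The iterates of `K` are 1-Lipschitz, so convergence passes to uniform limits and only the dense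
  -- span of the characters has to be treated.
  have hclosed : IsClosed {u | Tendsto (birkhoffAverage ℂ K id · u) atTop (𝓝 (P u))} :=
    isClosed_setOfPred_tendsto_birkhoffAverage ℂ hlip uniformContinuous_id P.continuous
  intro u
  have hu : u ∈ (Submodule.span ℂ (range <| @fourier T)).topologicalClosure := by
    rw [span_fourier_closure_eq_top]; trivial
  refine closure_minimal (fun v hv => ?_) hclosed hu
  simp only [hA, mem_ofPred_eq]
  refine Submodule.span_induction ?_ ?_ ?_ ?_ hv
  · rintro _ ⟨m, rfl⟩
    rcases eq_or_ne m 0 with rfl | hm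
    · have hK1 : Function.IsFixedPt K (fourier 0) := by
        ext x; rw [hKapp]; simp
      have hP1 : P (fourier 0) = fourier 0 := by
        ext x; rw [hPapp]; simp [haarIntegralCLM]
      rw [hP1]
      simp only [← hA]
      exact hK1.tendsto_birkhoffAverage ℂ id
    · have hP0 : P (fourier m) = 0 := by
        ext x
        rw [hPapp]
        exact haarIntegralCLM_fourier hm
      have hl : fourier m a - 1 ≠ (0 : ℂ) := by
        intro h0
        have h1 : AddCircle.toCircle (m • a) = AddCircle.toCircle (0 : AddCircle T) := by
          rw [AddCircle.toCircle_zero]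
          exact Circle.ext (by simpa [sub_eq_zero] using h0)
        exact ha m hm (AddCircle.injective_toCircle (Fact.out : 0 < T).ne' h1)
      -- A nontrivial character is a coboundary `K w - w`, so its averages telescope to O(1/n). The
      -- divisor is nonzero because m • a ≠ 0.
      set w : C(AddCircle T, ℂ) := (fourier m a - 1 : ℂ)⁻¹ • fourier m with hw
      have hKw : fourier m = K w - w := by
        ext x
        have : fourier m (x + a) = fourier m x * fourier m a := by
          simp [AddCircle.toCircle_add]
        simp only [hw, ContinuousMap.sub_apply, hKapp, ContinuousMap.smul_apply, smul_eq_mul, this]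
        field_simp
      have hbdd : Bornology.IsBounded (range (id <| K^[·] w)) := by
        refine isBounded_iff_forall_norm_le.2 ⟨‖w‖, Set.forall_mem_range.2 fun n => ?_⟩
        have H : K^[n] 0 = 0 := iterate_map_zero K n
        simpa [H] using (hlip.iterate n).dist_le_mul w 0
      have := tendsto_birkhoffAverage_apply_sub_birkhoffAverage ℂ hbdd
      simp only [hA, ← map_sub, ← hKw] at this
      rwa [hP0]
  · simp only [map_zero]
    exact tendsto_const_nhds
  · intro x y _ _ hx hy
    simp only [map_add]
    exact hx.add hy
  · intro c x _ hx
    simp only [map_smul]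
    exact hx.const_smul c

theorem tendstoUniformly_birkhoffMean_of_irrational {T : ℝ} (hT : 0 < T) {f : ℝ → ℝ}
    (hf : Continuous f) (hper : Function.Periodic f T) {φ : ℝ}
    (hφ : ∀ n m : ℤ, n ≠ 0 → n * φ ≠ m * T) :
    TendstoUniformly (birkhoffMean f φ) (fun _ => (1 / T) * ∫ t in (0 : ℝ)..T, f t) atTop := by
  have : Fact (0 < T) := ⟨hT⟩
  let h : C(AddCircle T, ℂ) := ⟨fun x => ((hper.lift x : ℝ) : ℂ),
    Complex.continuous_ofReal.comp (continuous_coinduced_dom.2 hf)⟩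
  have ha : ∀ n : ℤ, n ≠ 0 → n • (φ : AddCircle T) ≠ 0 := by
    intro n hn h0
    rw [← AddCircle.coe_zsmul, AddCircle.coe_eq_zero_iff] at h0
    obtain ⟨m, hm⟩ := h0
    exact hφ n m hn (by simpa using hm.symm)
  have key := tendsto_birkhoffAverage_addCircle ha h
  set K := (ContinuousMap.compRightAlgHom ℂ ℂ
    (ContinuousMap.addRight (φ : AddCircle T))).toLinearMap with hK
  have hKapp : ∀ (u : C(AddCircle T, ℂ)) x, K u x = u (x + φ) := fun u x => rfl
  have hiter : ∀ (j : ℕ) (t : ℝ), (K^[j] h) (t : AddCircle T) = ((f (t + j * φ) : ℝ) : ℂ) := by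
    intro j
    induction j with
    | zero => intro t; simp [h]
    | succ j ih =>
      intro t
      rw [Function.iterate_succ_apply', hKapp, ← AddCircle.coe_add, ih]
      push_cast; ring_nf
  have hint : haarIntegralCLM T h = (((1 / T) * ∫ t in (0 : ℝ)..T, f t : ℝ) : ℂ) := by
    change ∫ x, h x ∂AddCircle.haarAddCircle = _
    have := AddCircle.intervalIntegral_preimage T 0 h
    rw [zero_add] at this
    have h2 : ∀ t : ℝ, h (t : AddCircle T) = ((f t : ℝ) : ℂ) := fun t => by simp [h]
    simp only [h2, intervalIntegral.integral_ofReal] at this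
    rw [AddCircle.integral_haarAddCircle, ← this]
    simp
  rw [Metric.tendstoUniformly_iff]
  intro ε hε
  filter_upwards [Metric.tendsto_nhds.1 key ε hε] with n hn t
  have h1 := (ContinuousMap.dist_apply_le_dist (t : AddCircle T)).trans_lt hn
  have h2 : (birkhoffAverage ℂ K id n h) (t : AddCircle T) = ((birkhoffMean f φ n t : ℝ) : ℂ) := by
    simp [birkhoffAverage, birkhoffSum, birkhoffMean, hiter]
  rw [h2, ContinuousMap.const_apply, hint, Complex.dist_eq, ← Complex.ofReal_sub,
    Complex.norm_real] at h1
  rwa [dist_comm, Real.dist_eq]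

/-! ### Birkhoff means: periodic orbits, bounds, and suprema of uniform limits -/

theorem tendstoUniformly_birkhoffMean_of_periodic {f : ℝ → ℝ} {C : ℝ} (hC : ∀ t, |f t| ≤ C)
    {φ : ℝ} {q : ℕ} (hq : 0 < q) (hper : Function.Periodic f (q * φ)) :
    TendstoUniformly (birkhoffMean f φ) (birkhoffMean f φ q) atTop := by
  -- The discrepancy `d t n` is q-periodic in n, hence bounded uniformly in t and n; dividing by n
  -- sends it to 0.
  let d : ℝ → ℕ → ℝ := fun t n =>
    ∑ j ∈ Finset.range n, f (t + j * φ) - n / q * ∑ j ∈ Finset.range q, f (t + j * φ)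
  have hq' : (q : ℝ) ≠ 0 := by positivity
  have hC0 : 0 ≤ C := (abs_nonneg _).trans (hC 0)
  have hsum : ∀ t (n : ℕ), |∑ j ∈ Finset.range n, f (t + j * φ)| ≤ n * C := fun t n => by
    refine (Finset.abs_sum_le_sum_abs _ _).trans ((Finset.sum_le_sum fun j _ => hC _).trans ?_)
    simp
  have hd : ∀ t, Function.Periodic (d t) q := by
    intro t n
    simp only [d, add_comm n q, Finset.sum_range_add]
    have : ∀ j : ℕ, f (t + (q + j : ℕ) * φ) = f (t + j * φ) := fun j => by
      rw [← hper (t + j * φ)]; push_cast; ring_nf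
    simp only [this]
    set a := ∑ j ∈ Finset.range q, f (t + j * φ)
    set b := ∑ j ∈ Finset.range n, f (t + j * φ)
    push_cast
    field_simp
    ring
  have hbound : ∀ t n, |d t n| ≤ 2 * q * C := by
    intro t n
    rw [← (hd t).map_mod_nat n]
    have hlt : ((n % q : ℕ) : ℝ) ≤ q := by exact_mod_cast (Nat.mod_lt n hq).le
    have h1 := hsum t (n % q)
    have h2 : |((n % q : ℕ) : ℝ) / q * ∑ j ∈ Finset.range q, f (t + j * φ)| ≤ 1 * (q * C) := by
      rw [abs_mul]
      refine mul_le_mul ?_ (hsum t q) (abs_nonneg _) zero_le_one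
      rw [abs_of_nonneg (by positivity)]
      exact div_le_one_of_le₀ hlt (by positivity)
    have h3 : ((n % q : ℕ) : ℝ) * C ≤ q * C := by gcongr
    have h4 := abs_sub (∑ j ∈ Finset.range (n % q), f (t + j * φ))
      (((n % q : ℕ) : ℝ) / q * ∑ j ∈ Finset.range q, f (t + j * φ))
    simp only [d]
    linarith
  rw [Metric.tendstoUniformly_iff]
  intro ε hε
  have hlim : Tendsto (fun n : ℕ => 2 * q * C / (n : ℝ)) atTop (𝓝 0) :=
    tendsto_const_nhds.div_atTop tendsto_natCast_atTop_atTop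
  filter_upwards [hlim.eventually_lt_const hε, eventually_gt_atTop 0] with n hn hn0 t
  have hn0' : (n : ℝ) ≠ 0 := by positivity
  have : birkhoffMean f φ n t - birkhoffMean f φ q t = d t n / n := by
    simp only [birkhoffMean, d]
    set a := ∑ j ∈ Finset.range q, f (t + j * φ)
    set b := ∑ j ∈ Finset.range n, f (t + j * φ)
    field_simp
  rw [dist_comm, Real.dist_eq, this, abs_div, Nat.abs_cast]
  exact (div_le_div_of_nonneg_right (hbound t n) (by positivity)).trans_lt hn

/-- A mean over kn steps is the average of k means over n steps, so a bound at one time passes to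
the limit along the multiples of n. -/
theorem birkhoffMean_mul_le {f : ℝ → ℝ} {φ c : ℝ} {n : ℕ} (hn : 0 < n)
    (h : ∀ t, birkhoffMean f φ n t ≤ c) {k : ℕ} (hk : 0 < k) (t : ℝ) :
    birkhoffMean f φ (k * n) t ≤ c := by
  have hs : ∀ t, ∑ j ∈ Finset.range n, f (t + j * φ) ≤ n * c := fun t => by
    have := h t
    rw [birkhoffMean, one_div_mul_eq_div, div_le_iff₀ (by positivity)] at this
    linarith
  have hk' : ∀ k : ℕ, ∑ j ∈ Finset.range (k * n), f (t + j * φ) ≤ k * (n * c) := by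
    intro k
    induction k with
    | zero => simp
    | succ k ih =>
      rw [Nat.succ_mul, Finset.sum_range_add]
      have := hs (t + (k * n : ℕ) * φ)
      have h2 : ∀ j : ℕ, t + (k * n : ℕ) * φ + j * φ = t + (k * n + j : ℕ) * φ := fun j => by
        push_cast; ring
      simp only [h2] at this
      push_cast at *
      linarith
  rw [birkhoffMean, one_div_mul_eq_div, div_le_iff₀ (by positivity)]
  have := hk' k
  push_cast
  linarith

theorem birkhoffMean_mem_Icc {f : ℝ → ℝ} {C : ℝ} (h0 : ∀ t, 0 ≤ f t) (hC : ∀ t, f t ≤ C)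
    (φ : ℝ) (n : ℕ) (t : ℝ) : birkhoffMean f φ n t ∈ Icc 0 C := by
  refine ⟨mul_nonneg (by positivity) (Finset.sum_nonneg fun j _ => h0 _), ?_⟩
  rcases n.eq_zero_or_pos with rfl | hn
  · simpa [birkhoffMean] using (h0 t).trans (hC t)
  · rw [birkhoffMean, one_div_mul_eq_div, div_le_iff₀ (by positivity)]
    refine (Finset.sum_le_sum fun j _ => hC _).trans ?_
    simp [mul_comm]

theorem tendsto_iSup_of_tendstoUniformly {ι : Type*} [Nonempty ι] {F : ℕ → ι → ℝ} {L : ι → ℝ}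
    (hF : ∀ n, BddAbove (range (F n))) (hL : BddAbove (range L))
    (h : TendstoUniformly F L atTop) :
    Tendsto (fun n => ⨆ i, F n i) atTop (𝓝 (⨆ i, L i)) := by
  rw [Metric.tendsto_nhds]
  intro ε hε
  filter_upwards [Metric.tendstoUniformly_iff.1 h (ε / 2) (by positivity)] with n hn
  have hn' : ∀ i, -(ε / 2) < L i - F n i ∧ L i - F n i < ε / 2 := fun i => by
    have := hn i
    rwa [Real.dist_eq, abs_lt] at this
  have h1 : ⨆ i, F n i ≤ (⨆ i, L i) + ε / 2 :=
    ciSup_le fun i => by linarith [(hn' i).1, le_ciSup hL i]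
  have h2 : ⨆ i, L i ≤ (⨆ i, F n i) + ε / 2 :=
    ciSup_le fun i => by linarith [(hn' i).2, le_ciSup (hF n) i]
  rw [Real.dist_eq, abs_lt]
  constructor <;> linarith

/-! ### The four angular values as suprema of one limit function -/

theorem bddAbove_birkhoffMean_ellipseStep (φ ρ : ℝ) (n : ℕ) :
    BddAbove (range (birkhoffMean (ellipseStep φ ρ) φ n)) :=
  ⟨π, by
    rintro _ ⟨t, rfl⟩
    exact (birkhoffMean_mem_Icc (ellipseStep_nonneg φ ρ) (ellipseStep_le_pi φ ρ) φ n t).2⟩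

theorem bddAbove_of_tendstoUniformly_birkhoffMean {φ ρ : ℝ} {L : ℝ → ℝ}
    (hL : TendstoUniformly (birkhoffMean (ellipseStep φ ρ) φ) L atTop) : BddAbove (range L) :=
  ⟨π, by
    rintro _ ⟨t, rfl⟩
    exact le_of_tendsto' (hL.tendsto_at t) fun n =>
      (birkhoffMean_mem_Icc (ellipseStep_nonneg φ ρ) (ellipseStep_le_pi φ ρ) φ n t).2⟩

theorem firstAngularValue_eq_iSup {φ ρ : ℝ} (hρ : 0 < ρ) {L : ℝ → ℝ}
    (hL : TendstoUniformly (birkhoffMean (ellipseStep φ ρ) φ) L atTop) : firstAngularValue φ ρ = ⨆ t, L t := by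
  rw [firstAngularValue, outerLimsupValue, ← (ellipseLine_surjective hρ).iSup_comp]
  simp only [angleAverage_ellipseLine]
  exact iSup_congr fun t => (hL.tendsto_at t).limsup_eq

theorem outerLiminfValue_eq_iSup {φ ρ : ℝ} (hρ : 0 < ρ) {L : ℝ → ℝ}
    (hL : TendstoUniformly (birkhoffMean (ellipseStep φ ρ) φ) L atTop) : outerLiminfValue (modelSystem φ ρ) = ⨆ t, L t := by
  rw [outerLiminfValue, ← (ellipseLine_surjective hρ).iSup_comp]
  simp only [angleAverage_ellipseLine]
  exact iSup_congr fun t => (hL.tendsto_at t).liminf_eq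

theorem tendsto_iSup_angleAverage {φ ρ : ℝ} (hρ : 0 < ρ) {L : ℝ → ℝ}
    (hL : TendstoUniformly (birkhoffMean (ellipseStep φ ρ) φ) L atTop) :
    Tendsto (fun n : ℕ => ⨆ V : LineGrassmannian 2, angleAverage (modelSystem φ ρ) n V) atTop
      (𝓝 (⨆ t, L t)) := by
  simp only [← (ellipseLine_surjective hρ).iSup_comp, angleAverage_ellipseLine]
  exact tendsto_iSup_of_tendstoUniformly (bddAbove_birkhoffMean_ellipseStep φ ρ)
    (bddAbove_of_tendstoUniformly_birkhoffMean hL) hL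

theorem innerLimsupValue_eq_iSup {φ ρ : ℝ} (hρ : 0 < ρ) {L : ℝ → ℝ}
    (hL : TendstoUniformly (birkhoffMean (ellipseStep φ ρ) φ) L atTop) : innerLimsupValue (modelSystem φ ρ) = ⨆ t, L t :=
  (tendsto_iSup_angleAverage hρ hL).limsup_eq

theorem innerLiminfValue_eq_iSup {φ ρ : ℝ} (hρ : 0 < ρ) {L : ℝ → ℝ}
    (hL : TendstoUniformly (birkhoffMean (ellipseStep φ ρ) φ) L atTop) : innerLiminfValue (modelSystem φ ρ) = ⨆ t, L t :=
  (tendsto_iSup_angleAverage hρ hL).liminf_eq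

theorem tendstoUniformly_circleMean {φ ρ : ℝ} (hρ : 0 < ρ) (hφ : ¬ ∃ r : ℚ, φ = π * (r : ℝ)) :
    TendstoUniformly (birkhoffMean (ellipseStep φ ρ) φ) (fun _ => circleMean φ ρ) atTop := by
  rw [circleMean_eq hρ]
  -- The period π is doubled so that the limit is the mean over [0, 2π] in `circleMean`.
  refine tendstoUniformly_birkhoffMean_of_irrational (by positivity)
    (continuous_ellipseStep hρ φ) (by simpa using (ellipseStep_periodic φ ρ).nat_mul 2) ?_
  intro n m hn h
  refine hφ ⟨2 * m / n, ?_⟩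
  have : (n : ℝ) ≠ 0 := by exact_mod_cast hn
  push_cast
  field_simp
  linarith

theorem tendstoUniformly_birkhoffMean_ellipseStep {φ ρ : ℝ} {q : ℕ} (hq : 0 < q) {m : ℤ}
    (h : q * φ = m * π) :
    TendstoUniformly (birkhoffMean (ellipseStep φ ρ) φ) (birkhoffMean (ellipseStep φ ρ) φ q)
      atTop := by
  refine tendstoUniformly_birkhoffMean_of_periodic (C := π) (fun t => ?_) hq ?_
  · rw [abs_of_nonneg (ellipseStep_nonneg φ ρ t)]
    exact ellipseStep_le_pi φ ρ t
  · rw [h]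
    exact (ellipseStep_periodic φ ρ).int_mul m

theorem exists_tendstoUniformly_birkhoffMean {ρ : ℝ} (hρ : 0 < ρ) (φ : ℝ) :
    ∃ L, TendstoUniformly (birkhoffMean (ellipseStep φ ρ) φ) L atTop := by
  by_cases h : ∃ r : ℚ, φ = π * (r : ℝ)
  · obtain ⟨r, rfl⟩ := h
    refine ⟨_, tendstoUniformly_birkhoffMean_ellipseStep r.den_pos (m := r.num) ?_⟩
    have : (r.den : ℝ) * r = r.num := by exact_mod_cast r.den_mul_eq_num
    rw [← this]; ring
  · exact ⟨_, tendstoUniformly_circleMean hρ h⟩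

theorem isLUB_range_birkhoffMean {φ ρ : ℝ} (hρ : 0 < ρ) {q : ℕ} (hq : 0 < q) {m : ℤ}
    (h : q * φ = m * π) :
    IsLUB (range (birkhoffMean (ellipseStep φ ρ) φ q)) (firstAngularValue φ ρ) := by
  rw [firstAngularValue_eq_iSup hρ (tendstoUniformly_birkhoffMean_ellipseStep hq h)]
  exact isLUB_ciSup (bddAbove_birkhoffMean_ellipseStep φ ρ q)

theorem orbitMean_image_sphere {ρ : ℝ} (hρ : 0 < ρ) (φ : ℝ) (q : ℕ) :
    (fun x : EuclideanSpace ℝ (Fin 2) => orbitMean q x φ ρ) ''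
      Metric.sphere (0 : EuclideanSpace ℝ (Fin 2)) 1 =
    range (birkhoffMean (ellipseStep φ ρ) φ q) := by
  ext y
  constructor
  · rintro ⟨x, hx, rfl⟩
    obtain ⟨c, hc, t, rfl⟩ := exists_smul_ellipsePoint hρ (ne_zero_of_mem_unit_sphere ⟨x, hx⟩)
    exact ⟨t, (orbitMean_smul_ellipsePoint hρ φ t q hc).symm⟩
  · rintro ⟨t, rfl⟩
    have h0 := norm_ne_zero_iff.2 (ellipsePoint_ne_zero hρ t)
    refine ⟨‖ellipsePoint ρ t‖⁻¹ • ellipsePoint ρ t, ?_,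
      orbitMean_smul_ellipsePoint hρ φ t q (inv_ne_zero h0)⟩
    rw [mem_sphere_zero_iff_norm, norm_smul, norm_inv, norm_norm, inv_mul_cancel₀ h0]

/-! ### Upper semicontinuity -/

theorem firstAngularValue_le {φ ρ c : ℝ} (hρ : 0 < ρ) {n : ℕ} (hn : 0 < n)
    (h : ∀ t, birkhoffMean (ellipseStep φ ρ) φ n t ≤ c) : firstAngularValue φ ρ ≤ c := by
  obtain ⟨L, hL⟩ := exists_tendstoUniformly_birkhoffMean hρ φ
  rw [firstAngularValue_eq_iSup hρ hL]
  refine ciSup_le fun t => ?_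
  have hmul : Tendsto (fun k : ℕ => k * n) atTop atTop :=
    tendsto_id.atTop_mul_const' hn
  exact le_of_tendsto ((hL.tendsto_at t).comp hmul)
    ((eventually_gt_atTop 0).mono fun k hk => birkhoffMean_mul_le hn h hk t)

theorem exists_birkhoffMean_lt {φ ρ y : ℝ} (hρ : 0 < ρ) (h : firstAngularValue φ ρ < y) :
    ∃ n, 0 < n ∧ ∀ t, birkhoffMean (ellipseStep φ ρ) φ n t < y := by
  obtain ⟨L, hL⟩ := exists_tendstoUniformly_birkhoffMean hρ φ
  rw [firstAngularValue_eq_iSup hρ hL] at h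
  obtain ⟨n, hn, hn0⟩ := ((Metric.tendstoUniformly_iff.1 hL _ (sub_pos.2 h)).and
    (eventually_gt_atTop 0)).exists
  refine ⟨n, hn0, fun t => ?_⟩
  have h1 := hn t
  rw [dist_comm, Real.dist_eq] at h1
  have h2 := le_ciSup (bddAbove_of_tendstoUniformly_birkhoffMean hL) t
  linarith [(le_abs_self _).trans_lt h1]

theorem continuousAt_birkhoffMean_ellipseStep {ρ : ℝ} (hρ : 0 < ρ) (φ : ℝ) (n : ℕ) (t : ℝ) :
    ContinuousAt (fun z : (ℝ × ℝ) × ℝ =>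
      birkhoffMean (ellipseStep z.1.1 z.1.2) z.1.1 n z.2) ((φ, ρ), t) := by
  simp only [birkhoffMean]
  refine continuousAt_const.mul (tendsto_finsetSum _ fun j _ => ?_)
  have h : Continuous fun z : (ℝ × ℝ) × ℝ => (z.1, z.2 + j * z.1.1) := by fun_prop
  exact (continuousAt_ellipseStep hρ φ (t + j * φ)).tendsto.comp
    (h.tendsto ((φ, ρ), t))

theorem birkhoffMean_periodic {f : ℝ → ℝ} {T : ℝ} (hf : Function.Periodic f T) (φ : ℝ) (n : ℕ) :
    Function.Periodic (birkhoffMean f φ n) T := by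
  intro t
  simp only [birkhoffMean, add_right_comm t T, hf _]

theorem upperSemicontinuousAt_firstAngularValue {φ ρ : ℝ} (hρ : 0 < ρ) :
    UpperSemicontinuousAt (fun z : ℝ × ℝ => firstAngularValue z.1 z.2) (φ, ρ) := by
  intro y hy
  obtain ⟨y', hy', hyy⟩ := exists_between hy
  obtain ⟨n, hn, hlt⟩ := exists_birkhoffMean_lt hρ hy'
  -- Tube lemma over one period [0, π]; the parameters outside it are reached below by periodicity.
  have hev := (isCompact_Icc (a := (0 : ℝ)) (b := π)).eventually_forall_of_forall_eventually
    (x₀ := (φ, ρ)) (P := fun z t => birkhoffMean (ellipseStep z.1 z.2) z.1 n t < y')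
    fun t _ => (continuousAt_birkhoffMean_ellipseStep hρ φ n t).eventually_lt_const (hlt t)
  have hpos : ∀ᶠ z : ℝ × ℝ in 𝓝 (φ, ρ), 0 < z.2 :=
    continuousAt_snd.eventually_const_lt hρ
  filter_upwards [hev, hpos] with z hz hz0
  refine (firstAngularValue_le hz0 hn fun t => ?_).trans_lt hyy
  obtain ⟨s, hs, hst⟩ :=
    (birkhoffMean_periodic (ellipseStep_periodic z.1 z.2) z.1 n).exists_mem_Ico₀ pi_pos t
  rw [hst]
  exact (hz s (Ico_subset_Icc_self hs)).le

/-! ### Oriented angles at φ = π/q -/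

/-- The oriented angle from `ellipsePoint ρ t` to `ellipsePoint ρ (t + φ)`. -/
def orientedStep (φ ρ t : ℝ) : ℝ := ellipseAngle ρ (t + φ) - ellipseAngle ρ t

theorem ellipseStep_eq (φ ρ t : ℝ) : ellipseStep φ ρ t = arccos |cos (orientedStep φ ρ t)| := by
  rw [ellipseStep, orientedStep]

theorem abs_ellipseAngle_sub_lt (ρ t : ℝ) : |ellipseAngle ρ t - t| < π / 2 := by
  rw [ellipseAngle, add_sub_cancel_left]
  exact abs_lt.2 ⟨neg_pi_div_two_lt_arctan _, arctan_lt_pi_div_two _⟩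

/-- The right-hand sides are the inner product and the determinant of the two ellipse points. -/
theorem exists_polar_orientedStep {ρ : ℝ} (hρ : 0 < ρ) (φ t : ℝ) :
    ∃ r : ℝ, 0 < r ∧
      r * cos (orientedStep φ ρ t) = cos t * cos (t + φ) + ρ ^ 2 * (sin t * sin (t + φ)) ∧
      r * sin (orientedStep φ ρ t) = ρ * sin φ := by
  obtain ⟨r, hr, hc, hs⟩ := exists_polar_ellipseAngle hρ t
  obtain ⟨r', hr', hc', hs'⟩ := exists_polar_ellipseAngle hρ (t + φ)
  refine ⟨r * r', by positivity, ?_, ?_⟩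
  · rw [orientedStep, cos_sub, ← hc, ← hc']
    have : ρ ^ 2 * (sin t * sin (t + φ)) = (ρ * sin t) * (ρ * sin (t + φ)) := by ring
    rw [this, ← hs, ← hs']
    ring
  · have h1 : sin φ = sin (t + φ) * cos t - cos (t + φ) * sin t := by
      rw [← sin_sub, add_sub_cancel_left]
    rw [h1, orientedStep, sin_sub]
    linear_combination (r' * sin (ellipseAngle ρ (t + φ))) * hc + cos t * hs' -
      (r' * cos (ellipseAngle ρ (t + φ))) * hs - ρ * sin t * hc'

/-- The two arctangent corrections put the angle within π of φ, hence in (-π, 2π), where a positive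
sine forces it into (0, π). -/
theorem orientedStep_mem_Ioo {φ ρ : ℝ} (hρ : 0 < ρ) (hφ : φ ∈ Ioo 0 π) (t : ℝ) :
    orientedStep φ ρ t ∈ Ioo 0 π := by
  obtain ⟨r, hr, -, hs⟩ := exists_polar_orientedStep hρ φ t
  have hsin : 0 < sin (orientedStep φ ρ t) := by
    have : 0 < r * sin (orientedStep φ ρ t) := by
      rw [hs]; exact mul_pos hρ (sin_pos_of_mem_Ioo hφ)
    exact pos_of_mul_pos_right this hr.le
  obtain ⟨h1, h2⟩ := abs_lt.1 (abs_ellipseAngle_sub_lt ρ t)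
  obtain ⟨h3, h4⟩ := abs_lt.1 (abs_ellipseAngle_sub_lt ρ (t + φ))
  obtain ⟨h5, h6⟩ := hφ
  have h7 : -π < orientedStep φ ρ t := by rw [orientedStep]; linarith
  have h8 : orientedStep φ ρ t < 2 * π := by rw [orientedStep]; linarith
  constructor
  · by_contra! h
    exact absurd (sin_nonpos_of_nonpos_of_neg_pi_le h h7.le) (not_le.2 hsin)
  · by_contra! h
    have := sin_nonneg_of_nonneg_of_le_pi (x := orientedStep φ ρ t - π) (by linarith)
      (by linarith)
    rw [sin_sub_pi] at this
    linarith

theorem ellipseStep_eq_orientedStep {φ ρ : ℝ} (hρ : 0 < ρ) (hφ : φ ∈ Ioo 0 π) {t : ℝ}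
    (h : 0 ≤ cos t * cos (t + φ) + ρ ^ 2 * (sin t * sin (t + φ))) :
    ellipseStep φ ρ t = orientedStep φ ρ t := by
  obtain ⟨r, hr, hc, -⟩ := exists_polar_orientedStep hρ φ t
  obtain ⟨h1, h2⟩ := orientedStep_mem_Ioo hρ hφ t
  rw [← hc] at h
  rw [ellipseStep_eq, abs_of_nonneg (nonneg_of_mul_nonneg_right h hr), arccos_cos h1.le h2.le]

/-- A negative inner product means an obtuse oriented angle, which the principal angle replaces by
its supplement. -/
theorem ellipseStep_lt_orientedStep {φ ρ : ℝ} (hρ : 0 < ρ) (hφ : φ ∈ Ioo 0 π) {t : ℝ}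
    (h : cos t * cos (t + φ) + ρ ^ 2 * (sin t * sin (t + φ)) < 0) :
    ellipseStep φ ρ t < orientedStep φ ρ t := by
  obtain ⟨r, hr, hc, -⟩ := exists_polar_orientedStep hρ φ t
  obtain ⟨h1, h2⟩ := orientedStep_mem_Ioo hρ hφ t
  rw [← hc] at h
  have hneg : cos (orientedStep φ ρ t) < 0 := by
    by_contra! h'
    exact absurd (mul_nonneg hr.le h') (not_le.2 h)
  have hgt : π / 2 < orientedStep φ ρ t := by
    by_contra! h'
    exact absurd (cos_nonneg_of_mem_Icc ⟨by linarith, h'⟩) (not_le.2 hneg)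
  rw [ellipseStep_eq, abs_of_neg hneg, arccos_neg, arccos_cos h1.le h2.le]
  linarith

theorem ellipseStep_le_orientedStep {φ ρ : ℝ} (hρ : 0 < ρ) (hφ : φ ∈ Ioo 0 π) (t : ℝ) :
    ellipseStep φ ρ t ≤ orientedStep φ ρ t := by
  rcases lt_or_ge (cos t * cos (t + φ) + ρ ^ 2 * (sin t * sin (t + φ))) 0 with h | h
  · exact (ellipseStep_lt_orientedStep hρ hφ h).le
  · exact (ellipseStep_eq_orientedStep hρ hφ h).le

theorem birkhoffMean_orientedStep (φ ρ t : ℝ) {q : ℕ} (hqφ : q * φ = π) :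
    birkhoffMean (orientedStep φ ρ) φ q t = π / q := by
  have h : ∀ j : ℕ, orientedStep φ ρ (t + j * φ) =
      ellipseAngle ρ (t + (j + 1 : ℕ) * φ) - ellipseAngle ρ (t + j * φ) := fun j => by
    rw [orientedStep]; push_cast; ring_nf
  simp only [birkhoffMean, h]
  rw [Finset.sum_range_sub (fun j : ℕ => ellipseAngle ρ (t + j * φ)), hqφ, ellipseAngle_add_pi]
  simp [div_eq_inv_mul]

theorem birkhoffMean_ellipseStep_le {φ ρ : ℝ} (hρ : 0 < ρ) (hφ : φ ∈ Ioo 0 π) {q : ℕ}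
    (hqφ : q * φ = π) (t : ℝ) : birkhoffMean (ellipseStep φ ρ) φ q t ≤ π / q := by
  rw [← birkhoffMean_orientedStep φ ρ t hqφ]
  simp only [birkhoffMean]
  gcongr
  exact ellipseStep_le_orientedStep hρ hφ _

/-- The orbit starting at π/2 - φ hits the short axis at π/2, so no step of it straddles that axis.
Each inner product is (1 - ρ²) sin((j-1)φ) sin(jφ) + ρ² cos φ ≥ 0, so no step is obtuse. -/
theorem birkhoffMean_ellipseStep_eq {φ ρ : ℝ} (hρ : 0 < ρ) (hρ1 : ρ ≤ 1) (hφ : 0 < φ)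
    (hφ2 : φ ≤ π / 2) {q : ℕ} (hqφ : q * φ = π) :
    birkhoffMean (ellipseStep φ ρ) φ q (π / 2 - φ) = π / q := by
  have hπ := pi_pos
  rw [← birkhoffMean_orientedStep φ ρ (π / 2 - φ) hqφ]
  simp only [birkhoffMean]
  congr 1
  refine Finset.sum_congr rfl fun j hj =>
    ellipseStep_eq_orientedStep hρ ⟨hφ, by linarith⟩ ?_
  have hj : (j : ℝ) + 1 ≤ q := by exact_mod_cast Finset.mem_range.1 hj
  have e1 : π / 2 - φ + j * φ = (j * φ - φ) + π / 2 := by ring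
  have e2 : π / 2 - φ + j * φ + φ = j * φ + π / 2 := by ring
  rw [e2, e1, cos_add_pi_div_two, cos_add_pi_div_two, sin_add_pi_div_two, sin_add_pi_div_two]
  have hss : 0 ≤ sin (j * φ - φ) * sin (j * φ) := by
    rcases j.eq_zero_or_pos with rfl | hj0
    · simp
    · have hj1 : (1 : ℝ) ≤ j := by exact_mod_cast hj0
      have hle : j * φ ≤ π := by nlinarith
      have hge : φ ≤ j * φ := by nlinarith
      exact mul_nonneg (sin_nonneg_of_nonneg_of_le_pi (by linarith) (by linarith))
        (sin_nonneg_of_nonneg_of_le_pi (by linarith) hle)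
  have hcos : 0 ≤ cos (j * φ - φ) * cos (j * φ) + sin (j * φ - φ) * sin (j * φ) := by
    rw [← cos_sub, ← cos_neg]
    ring_nf
    exact cos_nonneg_of_mem_Icc ⟨by linarith, hφ2⟩
  have hρ2 : ρ ^ 2 ≤ 1 := pow_le_one₀ hρ.le hρ1
  have hρ3 : 0 ≤ ρ ^ 2 := sq_nonneg ρ
  nlinarith

theorem birkhoffMean_ellipseStep_lt {φ ρ : ℝ} (hρ : 0 < ρ) (hφ : φ ∈ Ioo 0 π) {q : ℕ}
    (hqφ : q * φ = π) (hρφ : ρ < tan (φ / 2)) :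
    birkhoffMean (ellipseStep φ ρ) φ q (π / 2 - φ / 2) < π / q := by
  have hq : 0 < q := Nat.pos_of_ne_zero fun h => by
    rw [h] at hqφ; simp [pi_ne_zero.symm] at hqφ
  rw [← birkhoffMean_orientedStep φ ρ (π / 2 - φ / 2) hqφ]
  simp only [birkhoffMean]
  refine mul_lt_mul_of_pos_left ?_ (by positivity)
  refine Finset.sum_lt_sum (fun j _ => ellipseStep_le_orientedStep hρ hφ _)
    ⟨0, Finset.mem_range.2 hq, ?_⟩
  rw [Nat.cast_zero, zero_mul, add_zero]
  refine ellipseStep_lt_orientedStep hρ hφ ?_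
  -- The first step straddles the short axis symmetrically; its inner product is ρ² cos²(φ/2) -
  -- sin²(φ/2), negative exactly because ρ < tan(φ/2).
  have e : π / 2 - φ / 2 + φ = φ / 2 + π / 2 := by ring
  rw [e, cos_add_pi_div_two, sin_add_pi_div_two, cos_pi_div_two_sub, sin_pi_div_two_sub]
  have hc : 0 < cos (φ / 2) := cos_pos_of_mem_Ioo ⟨by linarith [hφ.1, pi_pos], by linarith [hφ.2]⟩
  have h1 : ρ * cos (φ / 2) < sin (φ / 2) := by
    rwa [tan_eq_sin_div_cos, lt_div_iff₀ hc] at hρφ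
  have h2 : 0 < ρ * cos (φ / 2) := by positivity
  nlinarith

/-! ### Circle mean versus angular value: failure of lower semicontinuity -/

theorem continuous_birkhoffMean {f : ℝ → ℝ} (hf : Continuous f) (φ : ℝ) (n : ℕ) :
    Continuous (birkhoffMean f φ n) := by
  unfold birkhoffMean
  fun_prop

theorem integral_birkhoffMean {f : ℝ → ℝ} (hf : Continuous f) {T : ℝ}
    (hper : Function.Periodic f T) (φ : ℝ) {n : ℕ} (hn : 0 < n) :
    ∫ t in (0 : ℝ)..T, birkhoffMean f φ n t = ∫ t in (0 : ℝ)..T, f t := by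
  simp only [birkhoffMean]
  rw [intervalIntegral.integral_const_mul, intervalIntegral.integral_finsetSum
    fun j _ => (Continuous.intervalIntegrable (by fun_prop) _ _)]
  have : ∀ j : ℕ, ∫ t in (0 : ℝ)..T, f (t + j * φ) = ∫ t in (0 : ℝ)..T, f t := fun j => by
    rw [intervalIntegral.integral_comp_add_right, zero_add, add_comm T,
      hper.intervalIntegral_add_eq _ 0, zero_add]
  simp only [this, Finset.sum_const, Finset.card_range, nsmul_eq_mul]
  field_simp

theorem continuous_circleMean {ρ : ℝ} (hρ : 0 < ρ) : Continuous fun φ => circleMean φ ρ := by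
  simp only [circleMean_eq hρ]
  exact continuous_const.mul
    (intervalIntegral.continuous_parametric_intervalIntegral_of_continuous'
      (f := fun φ t => ellipseStep φ ρ t) (continuous_ellipseStep_uncurry hρ) 0 (2 * π))

theorem circleMean_lt_firstAngularValue {φ ρ : ℝ} (hρ : 0 < ρ) (hφ : 0 < φ) (hφ2 : φ ≤ π / 2)
    {q : ℕ} (hq : 0 < q) (hqφ : q * φ = π) (hρφ : ρ < tan (φ / 2)) :
    circleMean φ ρ < firstAngularValue φ ρ := by
  have hπ := pi_pos
  have hφ' : φ ∈ Ioo 0 π := ⟨hφ, by linarith⟩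
  have hρ1 : ρ ≤ 1 := by
    refine hρφ.le.trans ?_
    rw [← tan_pi_div_four]
    exact strictMonoOn_tan.monotoneOn ⟨by linarith, by linarith⟩ ⟨by linarith, by linarith⟩
      (by linarith)
  have h1 : π / q ≤ firstAngularValue φ ρ := by
    rw [← birkhoffMean_ellipseStep_eq hρ hρ1 hφ hφ2 hqφ]
    exact (isLUB_range_birkhoffMean hρ hq (m := 1) (by simpa using hqφ)).1 (mem_range_self _)
  refine lt_of_lt_of_le ?_ h1
  have hcont := continuous_ellipseStep hρ φ
  -- The q-step mean has the same integral as `ellipseStep` itself, is at most π/q everywhere, and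
  -- is strictly smaller at one point.
  have hlt := intervalIntegral.integral_lt_integral_of_continuousOn_of_le_of_exists_lt
    (a := 0) (b := 2 * π) (by positivity) (continuous_birkhoffMean hcont φ q).continuousOn
    (continuousOn_const (c := π / q)) (fun t _ => birkhoffMean_ellipseStep_le hρ hφ' hqφ t)
    ⟨π / 2 - φ / 2, ⟨by linarith, by linarith⟩, birkhoffMean_ellipseStep_lt hρ hφ' hqφ hρφ⟩
  rw [integral_birkhoffMean hcont (by simpa using (ellipseStep_periodic φ ρ).nat_mul 2) φ hq,
    intervalIntegral.integral_const, smul_eq_mul, sub_zero] at hlt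
  rw [circleMean_eq hρ, one_div_mul_eq_div, div_lt_iff₀ (by positivity)]
  linarith

theorem firstAngularValue_eq_circleMean {φ ρ : ℝ} (hρ : 0 < ρ)
    (hφ : ¬ ∃ r : ℚ, φ = π * (r : ℝ)) : firstAngularValue φ ρ = circleMean φ ρ := by
  rw [firstAngularValue_eq_iSup hρ (tendstoUniformly_circleMean hρ hφ), ciSup_const]

theorem not_lowerSemicontinuousAt_firstAngularValue {φ ρ : ℝ} (hρ : 0 < ρ)
    (h : circleMean φ ρ < firstAngularValue φ ρ) :
    ¬ LowerSemicontinuousAt (fun φ : ℝ => firstAngularValue φ ρ) φ := by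
  intro hl
  obtain ⟨y, hy1, hy2⟩ := exists_between h
  have hev : ∀ᶠ ψ in 𝓝 φ, y < firstAngularValue ψ ρ ∧ circleMean ψ ρ < y :=
    (hl y hy2).and ((continuous_circleMean hρ).continuousAt.eventually_lt_const hy1)
  have hpi : Tendsto (fun x : ℝ => π * x) (𝓝 (φ / π)) (𝓝 φ) := by
    have := (continuous_const_mul π).tendsto (φ / π)
    rwa [mul_div_cancel₀ _ pi_ne_zero] at this
  -- Irrational multiples of π accumulate at φ, and there the value coincides with `circleMean`.
  obtain ⟨x, hx, hxir⟩ := mem_closure_iff_nhds.1 (dense_irrational (φ / π)) _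
    (hpi.eventually hev)
  obtain ⟨h1, h2⟩ := hx
  rw [firstAngularValue_eq_circleMean hρ] at h1
  · exact lt_asymm h1 h2
  · rintro ⟨r, hr⟩
    exact hxir ⟨r, (mul_left_cancel₀ pi_ne_zero hr).symm⟩

end

theorem mainTheorem10 :
    (∀ φ ∈ Icc (0 : ℝ) (2 * π), ∀ ρ ∈ Ioc (0 : ℝ) 1,
      -- all four types of first angular values coincide (`firstAngularValue` is the outer one with limsup)
      outerLiminfValue (modelSystem φ ρ) = firstAngularValue φ ρ ∧
      innerLimsupValue (modelSystem φ ρ) = firstAngularValue φ ρ ∧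
      innerLiminfValue (modelSystem φ ρ) = firstAngularValue φ ρ ∧
      -- and they are given by the following formulas
      ((¬ ∃ r : ℚ, φ = π * (r : ℝ)) → firstAngularValue φ ρ = circleMean φ ρ) ∧
      (∀ p q : ℕ, 0 < q → Nat.Coprime p q → φ / (2 * π) = (p : ℝ) / (q : ℝ) →
        IsLUB ((fun x : EuclideanSpace ℝ (Fin 2) => orbitMean q x φ ρ) ''
          Metric.sphere (0 : EuclideanSpace ℝ (Fin 2)) 1) (firstAngularValue φ ρ))) ∧
    -- joint upper semicontinuity
    UpperSemicontinuousOn (fun z : ℝ × ℝ => firstAngularValue z.1 z.2)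
      (Icc (0 : ℝ) (2 * π) ×ˢ Ioc (0 : ℝ) 1) ∧
    -- failure of lower semicontinuity with respect to the angle
    (∀ q : ℕ, 2 ≤ q → ∀ ρ : ℝ, 0 < ρ → ρ < tan (π / (2 * (q : ℝ))) →
      ¬ LowerSemicontinuousWithinAt (fun φ : ℝ => firstAngularValue φ ρ)
        (Icc (0 : ℝ) (2 * π)) (π / (q : ℝ))) := by
  refine ⟨fun φ _ ρ hρ => ?_, fun z hz => ?_, fun q hq ρ hρ hρq => ?_⟩
  · obtain ⟨L, hL⟩ := exists_tendstoUniformly_birkhoffMean hρ.1 φ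
    have hfirst := firstAngularValue_eq_iSup hρ.1 hL
    refine ⟨(outerLiminfValue_eq_iSup hρ.1 hL).trans hfirst.symm,
      (innerLimsupValue_eq_iSup hρ.1 hL).trans hfirst.symm,
      (innerLiminfValue_eq_iSup hρ.1 hL).trans hfirst.symm,
      firstAngularValue_eq_circleMean hρ.1, fun p q hq _ hpq => ?_⟩
    rw [orbitMean_image_sphere hρ.1]
    refine isLUB_range_birkhoffMean hρ.1 hq (m := 2 * p) ?_
    rw [div_eq_div_iff (by positivity) (by positivity)] at hpq
    push_cast
    linarith
  · exact (upperSemicontinuousAt_firstAngularValue hz.2.1).upperSemicontinuousWithinAt _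
  · have hπ := pi_pos
    have hq2 : (2 : ℝ) ≤ q := by exact_mod_cast hq
    have hqpos : (0 : ℝ) < q := by linarith
    have hle : π / q ≤ π / 2 := by gcongr
    have hpos : 0 < π / q := by positivity
    -- Since π/q is interior, semicontinuity within the interval is semicontinuity at the point.
    have hnhds : Icc (0 : ℝ) (2 * π) ∈ 𝓝 (π / q) := Icc_mem_nhds hpos (by linarith)
    intro hl
    refine not_lowerSemicontinuousAt_firstAngularValue hρ
      (circleMean_lt_firstAngularValue hρ hpos hle (q := q) (by lia) ?_ ?_) fun y hy => ?_
    · field_simp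
    · rwa [div_div, mul_comm (q : ℝ)]
    · rw [← nhdsWithin_eq_nhds.2 hnhds]
      exact hl y hy
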